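/- **Setting.** Let $I\subset\mathbb R$ be a closed interval, $T:I\to I$ a map, and $I_1,\dots,I_\kappa\subset I$ ($\kappa<\infty$) pairwise disjoint Borel sets; put $S=\{1,\dots,\kappa\}$. For $\epsilon>0$ and $i\ne j$ in $S$ let $B^\epsilon_{i,j}\subset I$ be sets for which the holes $\Delta^\epsilon_{i,j}=T^{-1}(B^\epsilon_{i,j})\cap I_i$ are Borel, and define the metastable wells $\mathcal E^\epsilon_i=I_i\setminus\bigcup_{j\neq i}\Delta^\epsilon_{i,j}$. Let $(\Omega,\mathcal F,\mathbb P)$ be a probability space, $T_\epsilon:\Omega\times I\to I$ ($\epsilon>0$) jointly measurable random maps, and $\beta_\epsilon>0$ with $\beta_\epsilon\to\infty$ as $\epsilon\to0$. For a measurable random map $R:\Omega\times E\to E$ of a measurable space $E$, the *speeded-up jump process of $R$ started at $x\in E$* is $\xi(t)=\eta(\beta_\epsilon t)$, where $\eta$ visits successively the states $X_0=x$, $X_{n+1}=R(\omega_n,X_n)$, with $\omega_0,\omega_1,\dots$ i.i.d. of law $\mathbb P$, and holds each of them for a mean one exponential time, the holding times being i.i.d. and independent of $(X_n)$. Let $\xi_\epsilon$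 be the process of $R=T_\epsilon$, let $\boldsymbol P^\epsilon_x$ be its law when started at $x\in I$, let $$(\mathcal L_\epsilon F)(x)=\beta_\epsilon\big(\mathbb E[F(T_\epsilon(\cdot,x))]-F(x)\big)$$ be its generator, and let $H(A)=\inf\{t\ge0:\xi_\epsilon(t)\in A\}$. For $\epsilon>0$, $i\in S$ let $\mathcal V^\epsilon_i\subset I$ be a Borel set with $\mathcal E^\epsilon_i\subset\mathcal V^\epsilon_i$ and $\mathcal V^\epsilon_i\cap\mathcal E^\epsilon_j=\emptyset$ for $j\ne i$, and let $\tilde\xi^i_\epsilon$ be the speeded-up jump process of a measurable random map $\tilde T^i_\epsilon:\Omega\times\mathcal V^\epsilon_i\to\mathcal V^\epsilon_i$. Write $\delta_x\tilde{\mathcal P}^i_\epsilon(t)$ for the law of $\tilde\xi^i_\epsilon(t)$ started at $x$, and let $\tilde\mu^i_\epsilon$ be an invariant probability measure of $\tilde\xi^i_\epsilon$. Assume that, for every $x\in\mathcal E^\epsilon_i$, the processes $\xi_\epsilon$ and $\tilde\xi^i_\epsilon$ started at $x$ can be coupled so that, for every $t>0$, almost surely $\tilde\xi^i_\epsilon(t)=\xi_\epsilon(t)$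 on the event $t<H((\mathcal V^\epsilon_i)^c)$. With $d_{\rm TV}(\mu,\nu)=\frac12\sup_J|\int J\,d\mu-\int J\,d\nu|$, the supremum being over measurable $J$ with $|J|\le1$, define for $\varsigma>0$ $$t^{\epsilon,i}_{\rm mix}(\varsigma)=\inf\Big\{t>0:\ \sup_{x\in\mathcal E^\epsilon_i}d_{\rm TV}\big(\delta_x\tilde{\mathcal P}^i_\epsilon(t),\tilde\mu^i_\epsilon\big)\le\varsigma\Big\},\qquad \inf\emptyset=\infty .$$ **Condition $\mathfrak M$.** There are $h_\epsilon>0$ with $h_\epsilon\to0$ as $\epsilon\to0$ such that, for all $i\in S$, $$\lim_{\epsilon\to0}\ \sup_{x\in\mathcal E^\epsilon_i}\boldsymbol P^\epsilon_x\big[H((\mathcal V^\epsilon_i)^c)\le h_\epsilon\big]=0,$$ and there is $\varsigma_0>0$, independent of $\epsilon$, such that for all $i\in S$ and all $0<\varsigma<\varsigma_0$ one has $t^{\epsilon,i}_{\rm mix}(\varsigma)\le h_\epsilon$ for all sufficiently small $\epsilon>0$. **Condition $\mathfrak R^{(1)}$.** For all $\lambda>0$ and $g:S\to\mathbb R$,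 and with $G_\epsilon=\sum_{i\in S}g(i)\,\chi_{\mathcal E^\epsilon_i}$, the resolvent equation $(\lambda-\mathcal L_\epsilon)F_\epsilon=G_\epsilon$ on $I$ has for every $\epsilon>0$ a unique bounded measurable solution $F_\epsilon:I\to\mathbb R$, and $$\lim_{\epsilon\to0}\ \sup_{x,y\in\mathcal E^\epsilon_i}|F_\epsilon(x)-F_\epsilon(y)|=0\qquad\text{for all } i\in S.$$ **Proposition 3.1.** If condition $\mathfrak M$ holds, then condition $\mathfrak R^{(1)}$ holds. -/

import Mathlib

open MeasureTheory Set Filter Topology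

noncomputable section

namespace Metastability

/-! ### The Markov jump process induced by a random map -/

instance isProbabilityMeasure_exp_one :
    IsProbabilityMeasure (ProbabilityTheory.expMeasure 1) :=
  ProbabilityTheory.isProbabilityMeasure_expMeasure one_pos

section JumpLaw

variable {Ω E : Type*} [MeasurableSpace Ω] [MeasurableSpace E]

/-- The orbit `X₀ = x`, `Xₙ₊₁ = R(ωₙ, Xₙ)` of a random map `R` along a noise sequence `ω`. -/
def chain (R : Ω → E → E) (x : E) (ω : ℕ → Ω) : ℕ → E
  | 0 => x
  | n + 1 => R (ω n) (chain R x ω n)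

/-- A trajectory of a jump process, coded by the sequence `(Xₙ)` of successively visited states
and the sequence `(eₙ)` of holding times: the state `Xₙ` is held for the time `eₙ`. -/
abbrev Trajectory (E : Type*) : Type _ := (ℕ → E) × (ℕ → ℝ)

/-- The number of jumps in `[0, t]`: the `(n+1)`-st jump occurs at time `e₀ + ⋯ + eₙ`. -/
def jumpCount (e : ℕ → ℝ) (t : ℝ) : ℕ :=
  {n : ℕ | ∑ k ∈ Finset.range (n + 1), e k ≤ t}.ncard

/-- The state at time `t`. -/
def stateAt (t : ℝ) (w : Trajectory E) : E := w.1 (jumpCount w.2 t)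

/-- The law of the Markov jump process `η` started at `x`: the visited states form the Markov chain
driven by independent noises with law `P`, and the holding times are independent mean one
exponential variables, independent of the chain. -/
def jumpLaw (P : Measure Ω) [IsProbabilityMeasure P] (R : Ω → E → E) (x : E) :
    Measure (Trajectory E) :=
  ((Measure.infinitePi fun _ : ℕ => P).map (chain R x)).prod
    (Measure.infinitePi fun _ : ℕ => ProbabilityTheory.expMeasure 1)

/-- The speeded-up process `ξ(t) = η(β t)`. -/
def speeded (β t : ℝ) (w : Trajectory E) : E := stateAt (β * t) w

/-- The hitting time `inf {t ≥ 0 : ξ(t) ∈ A}` of the speeded-up process (`∞` if `A` is never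
hit). -/
def hittingTime (β : ℝ) (A : Set E) (w : Trajectory E) : ENNReal :=
  ⨅ (t : ℝ) (_ : 0 ≤ t ∧ speeded β t w ∈ A), ENNReal.ofReal t

/-- The distribution `δₓ 𝒫(t)` at time `t` of the speeded-up process started at `x`. -/
def semigroupMeasure (P : Measure Ω) [IsProbabilityMeasure P] (R : Ω → E → E) (β t : ℝ) (x : E) :
    Measure E :=
  (jumpLaw P R x).map (speeded β t)

/-- `μ` is invariant under the semigroup of the speeded-up process. -/
def IsInvariant (P : Measure Ω) [IsProbabilityMeasure P] (R : Ω → E → E) (β : ℝ)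
    (μ : Measure E) : Prop :=
  ∀ t : ℝ, 0 ≤ t → ∀ A : Set E, MeasurableSet A →
    ∫⁻ x, semigroupMeasure P R β t x A ∂μ = μ A

/-- The generator `β (𝕄ˣ[F] - F(x))` of the speeded-up process, `𝕄ˣ` being the law of `R(·, x)`. -/
def generator (P : Measure Ω) (R : Ω → E → E) (β : ℝ) (F : E → ℝ) (x : E) : ℝ :=
  β * (∫ y, F y ∂(P.map fun ω => R ω x) - F x)

/-- `F` is a bounded measurable solution of the resolvent equation `(l - 𝓛) F = G`. -/
def IsResolventSolution (P : Measure Ω) (R : Ω → E → E) (β l : ℝ) (G F : E → ℝ) : Prop :=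
  Measurable F ∧ (∃ C, ∀ x, |F x| ≤ C) ∧ ∀ x, l * F x - generator P R β F x = G x

/-- Total variation distance
`½ sup |∫ J dμ - ∫ J dν|`, over the measurable functions `J` bounded by one. -/
def tvDist (μ ν : Measure E) : ℝ :=
  (1 / 2) * ⨆ J : {J : E → ℝ // Measurable J ∧ ∀ x, |J x| ≤ 1},
    |∫ x, J.1 x ∂μ - ∫ x, J.1 x ∂ν|

/-- The mixing time `inf {t > 0 : sup_{x ∈ A} d_TV(δₓ 𝒫(t), μ) ≤ s}` started from a set `A`
(`∞` if there is no such `t`). -/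
def mixingTime (P : Measure Ω) [IsProbabilityMeasure P] (R : Ω → E → E) (β : ℝ) (μ : Measure E)
    (A : Set E) (s : ℝ) : ENNReal :=
  ⨅ (t : ℝ) (_ : 0 < t ∧ ∀ x ∈ A, tvDist (semigroupMeasure P R β t x) μ ≤ s), ENNReal.ofReal t

end JumpLaw

/-! ### Perturbed maps, holes and wells -/

/-- A map `T` of a closed interval `I` with components `I₁, …, I_κ`, the sets `B_{i,j}^ε` that define
the holes, the random perturbations `T_ε` of `T` and the time scale `β_ε`. -/
structure PerturbedMap (Ω : Type*) [MeasurableSpace Ω] (I : Set ℝ) where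
  isClosed : IsClosed I
  ordConnected : I.OrdConnected
  κ : ℕ
  T : I → I
  comp : Fin κ → Set I
  measurableSet_comp : ∀ i, MeasurableSet (comp i)
  disjoint_comp : ∀ i j, i ≠ j → Disjoint (comp i) (comp j)
  B : ℝ → Fin κ → Fin κ → Set I
  measurableSet_hole : ∀ ε > 0, ∀ i j, i ≠ j → MeasurableSet (T ⁻¹' B ε i j ∩ comp i)
  Tε : ℝ → Ω → I → I
  measurable_Tε : ∀ ε > 0, Measurable (Function.uncurry (Tε ε))
  β : ℝ → ℝ
  β_pos : ∀ ε > 0, 0 < β ε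
  tendsto_β : Tendsto β (𝓝[>] 0) atTop

namespace PerturbedMap

variable {Ω : Type*} [MeasurableSpace Ω] {I : Set ℝ} (M : PerturbedMap Ω I)

/-- The hole `Δ_{i,j}^ε` from `I_i` to `I_j`. -/
def hole (ε : ℝ) (i j : Fin M.κ) : Set I := M.T ⁻¹' M.B ε i j ∩ M.comp i

/-- The metastable well `ℰ_i^ε = I_i \ ⋃_{j ≠ i} Δ_{i,j}^ε`. -/
def well (ε : ℝ) (i : Fin M.κ) : Set I := M.comp i \ ⋃ (j : Fin M.κ) (_ : j ≠ i), M.hole ε i j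

/-- The function equal to `g(i)` on the well `ℰ_i^ε`, and to zero off the wells. -/
def wellFunction (g : Fin M.κ → ℝ) (ε : ℝ) (x : I) : ℝ :=
  ∑ i, g i * (M.well ε i).indicator 1 x

/-- The resolvent equation has a unique solution `F_ε`, and `F_ε` is asymptotically constant on
each well. -/
def AsymptoticallyConstant (P : Measure Ω) : Prop :=
  ∀ l : ℝ, 0 < l → ∀ g : Fin M.κ → ℝ, ∃ F : ℝ → I → ℝ,
    (∀ ε > 0, IsResolventSolution P (M.Tε ε) (M.β ε) l (M.wellFunction g ε) (F ε) ∧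
      ∀ F', IsResolventSolution P (M.Tε ε) (M.β ε) l (M.wellFunction g ε) F' → F' = F ε) ∧
    ∀ i, Tendsto (fun ε => ⨆ x ∈ M.well ε i, ⨆ y ∈ M.well ε i, ENNReal.ofReal |F ε x - F ε y|)
      (𝓝[>] 0) (𝓝 0)

/-- Larger wells `𝒱_i^ε` and, on each of them, the process induced by a random map `R ε i` of
`𝒱_i^ε`, speeded-up by `β_ε`, with an invariant probability measure `μ ε i`. Started at a common
point of `ℰ_i^ε`, it can be coupled with the process `ξ_ε` in such a way that both agree until `ξ_ε`
leaves `𝒱_i^ε`. -/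
structure RestrictedProcesses (P : Measure Ω) [IsProbabilityMeasure P] where
  V : ℝ → Fin M.κ → Set I
  measurableSet_V : ∀ ε > 0, ∀ i, MeasurableSet (V ε i)
  well_subset : ∀ ε > 0, ∀ i, M.well ε i ⊆ V ε i
  disjoint_well : ∀ ε > 0, ∀ i j, i ≠ j → Disjoint (V ε i) (M.well ε j)
  R : ∀ (ε : ℝ) (i : Fin M.κ), Ω → V ε i → V ε i
  measurable_R : ∀ ε > 0, ∀ i, Measurable (Function.uncurry (R ε i))
  μ : ∀ (ε : ℝ) (i : Fin M.κ), Measure (V ε i)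
  isProbabilityMeasure_μ : ∀ ε > 0, ∀ i, IsProbabilityMeasure (μ ε i)
  isInvariant_μ : ∀ ε > 0, ∀ i, IsInvariant P (R ε i) (M.β ε) (μ ε i)
  coupling : ∀ ε > 0, ∀ i, ∀ x : V ε i, (x : I) ∈ M.well ε i →
    ∃ Q : Measure (Trajectory I × Trajectory (V ε i)),
      Q.map Prod.fst = jumpLaw P (M.Tε ε) (x : I) ∧
      Q.map Prod.snd = jumpLaw P (R ε i) x ∧
      ∀ t > 0, ∀ᵐ w ∂Q, ENNReal.ofReal t < hittingTime (M.β ε) (V ε i)ᶜ w.1 →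
        ((speeded (M.β ε) t w.2 : V ε i) : I) = speeded (M.β ε) t w.1

/-- The mixing condition: there is a time scale `h_ε ≪ 1` within which `ξ_ε` started in `ℰ_i^ε` does
not leave `𝒱_i^ε`, and by which the restricted process started in `ℰ_i^ε` is mixed. -/
def RestrictedProcesses.Mixing {M : PerturbedMap Ω I} {P : Measure Ω} [IsProbabilityMeasure P]
    (D : M.RestrictedProcesses P) : Prop :=
  ∃ h : ℝ → ℝ, (∀ ε > 0, 0 < h ε) ∧ Tendsto h (𝓝[>] 0) (𝓝 0) ∧
    (∀ i, Tendsto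
      (fun ε => ⨆ x ∈ M.well ε i, jumpLaw P (M.Tε ε) x
        {w | hittingTime (M.β ε) (D.V ε i)ᶜ w ≤ ENNReal.ofReal (h ε)})
      (𝓝[>] 0) (𝓝 0)) ∧
    ∃ s₀ : ℝ, 0 < s₀ ∧ ∀ i, ∀ s : ℝ, 0 < s → s < s₀ → ∀ᶠ ε in 𝓝[>] 0,
      mixingTime P (D.R ε i) (M.β ε) (D.μ ε i) (Subtype.val ⁻¹' M.well ε i) s
        ≤ ENNReal.ofReal (h ε)

end PerturbedMap

end Metastability

end

/-!
Write `K` for the transition operator of the random map `T_ε`, so that the generator is `β_ε (K - 1)`.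

The resolvent equation `(l - 𝓛) F = G` is solved by a Neumann series (`exists_isResolventSolution`).
By the maximum principle a bounded solution satisfies `|F| ≤ sup |G| / l`
(`IsResolventSolution.abs_le`); this gives uniqueness and, as `G_ε` is bounded uniformly in `ε`, a
bound on `F_ε` that does not depend on `ε`.

Asymptotic constancy follows by comparing `F_ε x`, for `x` in the well `ℰ_i`, with the number
`∫ F_ε dμ_i`, which does not depend on `x`
(`RestrictedProcesses.abs_sub_integral_le`). There is a time `t ≤ h_ε` at
which the restricted process is mixed up to `s` (`exists_time_of_mixingTime_le`), and three errors
are made.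

* `F_ε x` against the expectation of `F_ε` at time `t` along `ξ_ε`: since
  `β_ε (K F_ε - F_ε) = l F_ε - G_ε` is bounded, one step of the chain costs `O(1 / β_ε)`. The expected
  number of steps up to time `t` is `O(β_ε t)` by Chernoff bounds on the jump times
  (`integral_jumpCount_le`), so the error is `O(h_ε)`
  (`IsResolventSolution.abs_integral_speeded_sub_le`).
* `ξ_ε` against the restricted process: by the coupling, the error is at most `2 sup |F_ε|` times the
  probability of leaving `𝒱_i` up to time `h_ε` (`abs_integral_sub_le_of_coupling`).
* the restricted process at time `t` against its invariant measure: at most `2 sup |F_ε| s`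
  (`abs_integral_sub_le_tvDist`).

The first two errors vanish in the limit, and `s` is arbitrarily small.
-/

open MeasureTheory Set Filter Topology

noncomputable section

namespace Metastability

/-! ### Counting the jumps -/

/-- The set of indices of the jumps that occur in `[0, t]`; `jumpCount` is its `ncard`. -/
def jumpIndices (e : ℕ → ℝ) (t : ℝ) : Set ℕ := {n | ∑ k ∈ Finset.range (n + 1), e k ≤ t}

lemma jumpCount_eq_ncard (e : ℕ → ℝ) (t : ℝ) : jumpCount e t = (jumpIndices e t).ncard := rfl

lemma jumpIndices_mono (e : ℕ → ℝ) : Monotone (jumpIndices e) :=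
  fun _ _ hst _ hn => le_trans hn hst

/-- The number of jumps in `[0, t]`, with value `∞` if there are infinitely many. -/
def jumpCountENN (e : ℕ → ℝ) (t : ℝ) : ENNReal := ∑' n, (jumpIndices e t).indicator 1 n

lemma measurableSet_mem_jumpIndices (t : ℝ) (n : ℕ) :
    MeasurableSet {e : ℕ → ℝ | n ∈ jumpIndices e t} :=
  measurableSet_le (f := fun e : ℕ → ℝ => ∑ k ∈ Finset.range (n + 1), e k) (by fun_prop)
    measurable_const

lemma measurable_jumpCountENN (t : ℝ) : Measurable fun e => jumpCountENN e t := by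
  refine Measurable.tsum fun n => ?_
  exact (measurable_one (α := ENNReal)).indicator (measurableSet_mem_jumpIndices t n)

lemma jumpCountENN_eq_encard (e : ℕ → ℝ) (t : ℝ) :
    jumpCountENN e t = ((jumpIndices e t).encard : ENNReal) := by
  rw [jumpCountENN, ← ENNReal.tsum_set_one, tsum_subtype (jumpIndices e t) (fun _ => (1 : ENNReal))]
  rfl

lemma jumpCount_eq_floor (e : ℕ → ℝ) (t : ℝ) :
    jumpCount e t = ⌊(jumpCountENN e t).toReal⌋₊ := by
  rw [jumpCountENN_eq_encard, jumpCount_eq_ncard]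
  rcases (jumpIndices e t).finite_or_infinite with h | h
  · rw [← h.cast_ncard_eq]
    simp
  · simp [h.encard_eq, h.ncard]

lemma measurable_jumpCount (t : ℝ) : Measurable fun e => jumpCount e t := by
  simp_rw [jumpCount_eq_floor]
  exact Nat.measurable_floor.comp (measurable_jumpCountENN t).ennreal_toReal

lemma natCast_jumpCount_le (e : ℕ → ℝ) (t : ℝ) : (jumpCount e t : ENNReal) ≤ jumpCountENN e t := by
  rw [jumpCountENN_eq_encard, jumpCount_eq_ncard]
  exact_mod_cast (jumpIndices e t).ncard_le_encard

lemma mgf_expMeasure_one {θ : ℝ} (hθ : 0 < θ) :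
    ProbabilityTheory.mgf id (ProbabilityTheory.expMeasure 1) (-θ) = (1 + θ)⁻¹ := by
  have hθ' : 0 < 1 + θ := by linarith
  -- The tilted density is a multiple of the density of the exponential law of rate `1 + θ`.
  have key : ∀ x, ProbabilityTheory.gammaPDF 1 1 x * ENNReal.ofReal (Real.exp (-θ * x)) =
      ENNReal.ofReal (1 + θ)⁻¹ * ProbabilityTheory.gammaPDF 1 (1 + θ) x := by
    intro x
    rcases lt_or_ge x 0 with hx | hx
    · simp [ProbabilityTheory.gammaPDF_of_neg hx]
    · rw [ProbabilityTheory.gammaPDF_of_nonneg hx, ProbabilityTheory.gammaPDF_of_nonneg hx,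
        ← ENNReal.ofReal_mul (by positivity), ← ENNReal.ofReal_mul (by positivity)]
      congr 1
      have : Real.exp (-((1 + θ) * x)) = Real.exp (-(1 * x)) * Real.exp (-θ * x) := by
        rw [← Real.exp_add]; ring_nf
      rw [this]
      simp
      field_simp
  rw [ProbabilityTheory.mgf, integral_eq_lintegral_of_nonneg_ae (ae_of_all _ fun x => by positivity)
    (by fun_prop)]
  have hm : Measurable (ProbabilityTheory.gammaPDF 1 1) :=
    (ProbabilityTheory.measurable_gammaPDFReal 1 1).ennreal_ofReal
  have hm' : Measurable (ProbabilityTheory.gammaPDF 1 (1 + θ)) :=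
    (ProbabilityTheory.measurable_gammaPDFReal 1 (1 + θ)).ennreal_ofReal
  rw [ProbabilityTheory.expMeasure, ProbabilityTheory.gammaMeasure,
    lintegral_withDensity_eq_lintegral_mul _ hm (by fun_prop)]
  simp only [Pi.mul_apply, id, key]
  rw [lintegral_const_mul _ hm', ProbabilityTheory.lintegral_gammaPDF_eq_one one_pos hθ', mul_one,
    ENNReal.toReal_ofReal (by positivity)]

/-- The law of the sequence of holding times. -/
abbrev clockLaw : Measure (ℕ → ℝ) :=
  Measure.infinitePi fun _ : ℕ => ProbabilityTheory.expMeasure 1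

/-- Chernoff bound for the time of the `(n + 1)`-st jump. -/
lemma clockLaw_mem_jumpIndices_le {θ s : ℝ} (hθ : 0 < θ) (n : ℕ) :
    clockLaw {e | n ∈ jumpIndices e s} ≤
      ENNReal.ofReal (Real.exp (θ * s) * (1 + θ)⁻¹ ^ (n + 1)) := by
  have hind : ProbabilityTheory.iIndepFun (fun (k : ℕ) (e : ℕ → ℝ) => e k) clockLaw :=
    ProbabilityTheory.iIndepFun_infinitePi (X := fun _ x => x) (fun _ => measurable_id)
  have hmgf1 : ∀ k, ProbabilityTheory.mgf (fun e : ℕ → ℝ => e k) clockLaw (-θ) = (1 + θ)⁻¹ := by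
    intro k
    rw [← mgf_expMeasure_one hθ, ← Measure.infinitePi_map_eval
      (fun _ : ℕ => ProbabilityTheory.expMeasure 1) k,
      ProbabilityTheory.mgf_id_map (measurable_pi_apply k).aemeasurable]
  have hmgf : ProbabilityTheory.mgf (∑ k ∈ Finset.range (n + 1), fun e : ℕ → ℝ => e k)
      clockLaw (-θ) = (1 + θ)⁻¹ ^ (n + 1) := by
    rw [hind.mgf_sum (fun k => by fun_prop)]
    simp [hmgf1]
  have hint : Integrable (fun e => Real.exp (-θ * (∑ k ∈ Finset.range (n + 1),
      fun e : ℕ → ℝ => e k) e)) clockLaw := by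
    by_contra hcon
    have := ProbabilityTheory.mgf_undef hcon
    rw [hmgf] at this
    have : 0 < (1 + θ)⁻¹ ^ (n + 1) := by positivity
    linarith
  have := ProbabilityTheory.measure_le_le_exp_mul_mgf s (by linarith) hint
  rw [hmgf, neg_neg] at this
  rw [ENNReal.le_ofReal_iff_toReal_le (measure_ne_top _ _) (by positivity)]
  simpa [Measure.real, jumpIndices] using this

/-- The expected number of jumps in `[0, s]` grows at most linearly. The optimal constant is `1`;
the constant `exp 1` comes from the Chernoff bounds with parameter `1 / s`. -/
lemma lintegral_jumpCountENN_le {s : ℝ} (hs : 0 < s) :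
    ∫⁻ e, jumpCountENN e s ∂clockLaw ≤ ENNReal.ofReal (Real.exp 1 * s) := by
  have hθ : 0 < 1 / s := by positivity
  have hr : (1 + 1 / s)⁻¹ < 1 := inv_lt_one_of_one_lt₀ (by linarith)
  have hr0 : 0 ≤ (1 + 1 / s)⁻¹ := by positivity
  have hmeas : ∀ n, AEMeasurable (fun e => (jumpIndices e s).indicator (1 : ℕ → ENNReal) n)
      clockLaw := fun n => ((measurable_one (α := ENNReal)).indicator
    (measurableSet_mem_jumpIndices s n)).aemeasurable
  unfold jumpCountENN
  rw [lintegral_tsum hmeas]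
  have h1 : ∀ n, ∫⁻ e, (jumpIndices e s).indicator (1 : ℕ → ENNReal) n ∂clockLaw =
      clockLaw {e | n ∈ jumpIndices e s} := fun n =>
    lintegral_indicator_one (measurableSet_mem_jumpIndices s n)
  simp_rw [h1]
  have hsum := (hasSum_geometric_of_lt_one hr0 hr).mul_left
    (Real.exp (1 / s * s) * (1 + 1 / s)⁻¹)
  calc _ ≤ ∑' n, ENNReal.ofReal (Real.exp (1 / s * s) * (1 + 1 / s)⁻¹ * (1 + 1 / s)⁻¹ ^ n) := by
        refine ENNReal.tsum_le_tsum fun n => ?_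
        rw [mul_assoc, ← pow_succ']
        exact clockLaw_mem_jumpIndices_le hθ n
    _ = ENNReal.ofReal (Real.exp 1 * s) := by
        rw [← ENNReal.ofReal_tsum_of_nonneg (fun n => by positivity) hsum.summable, hsum.tsum_eq]
        congr 1
        have h1 : 1 / s * s = 1 := by field_simp
        rw [h1]
        field_simp
        simp

lemma lintegral_jumpCount_le {s : ℝ} (hs : 0 < s) :
    ∫⁻ e, (jumpCount e s : ENNReal) ∂clockLaw ≤ ENNReal.ofReal (Real.exp 1 * s) :=
  (lintegral_mono fun e => natCast_jumpCount_le e s).trans (lintegral_jumpCountENN_le hs)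

lemma integrable_jumpCount {s : ℝ} (hs : 0 < s) :
    Integrable (fun e => (jumpCount e s : ℝ)) clockLaw := by
  refine ⟨(measurable_from_nat.comp (measurable_jumpCount s)).aestronglyMeasurable, ?_⟩
  refine lt_of_le_of_lt ?_ (lt_of_le_of_lt (lintegral_jumpCount_le hs) ENNReal.ofReal_lt_top)
  exact lintegral_mono fun e => by simp

lemma integral_jumpCount_le {s : ℝ} (hs : 0 < s) :
    ∫ e, (jumpCount e s : ℝ) ∂clockLaw ≤ Real.exp 1 * s := by
  rw [integral_eq_lintegral_of_nonneg_ae (ae_of_all _ fun e => by positivity)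
    (integrable_jumpCount hs).1]
  refine ENNReal.toReal_le_of_le_ofReal (by positivity) ?_
  simpa using lintegral_jumpCount_le hs

lemma ae_finite_jumpIndices (s : ℝ) : ∀ᵐ e ∂clockLaw, (jumpIndices e s).Finite := by
  have hs : 0 < max s 1 := by positivity
  have h := ae_lt_top (measurable_jumpCountENN (max s 1))
    (ne_top_of_le_ne_top ENNReal.ofReal_ne_top (lintegral_jumpCountENN_le hs))
  filter_upwards [h] with e he
  refine Set.Finite.subset ?_ (jumpIndices_mono e (le_max_left s 1))
  rw [← Set.encard_lt_top_iff]
  rw [jumpCountENN_eq_encard] at he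
  exact_mod_cast he

/-- Almost surely, the jump counting process is right-continuous at a given time. -/
lemma ae_eventually_jumpCount_eq (s : ℝ) :
    ∀ᵐ e ∂clockLaw, ∀ᶠ t in 𝓝[>] s, jumpCount e t = jumpCount e s := by
  filter_upwards [ae_finite_jumpIndices (s + 1)] with e he
  -- Only the finitely many jumps in `(s, s + 1]` have to be avoided.
  have hfin : (jumpIndices e (s + 1) \ jumpIndices e s).Finite := he.subset sdiff_subset
  have hev : ∀ᶠ t in 𝓝[>] s, ∀ n ∈ jumpIndices e (s + 1) \ jumpIndices e s,
      t < ∑ k ∈ Finset.range (n + 1), e k := by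
    rw [Filter.eventually_all_finite hfin]
    intro n hn
    exact nhdsWithin_le_nhds (eventually_lt_nhds (not_le.1 hn.2))
  filter_upwards [hev, self_mem_nhdsWithin,
    nhdsWithin_le_nhds (eventually_lt_nhds (lt_add_one s))] with t ht hst ht1
  rw [jumpCount_eq_ncard, jumpCount_eq_ncard]
  congr 1
  refine Subset.antisymm (fun n hn => ?_) (jumpIndices_mono e (le_of_lt hst))
  by_contra hns
  exact absurd (ht n ⟨jumpIndices_mono e ht1.le hn, hns⟩) (not_lt.2 hn)

/-! ### The resolvent equation -/

section Resolvent

variable {Ω E : Type*} [MeasurableSpace Ω] [MeasurableSpace E]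

/-- The transition operator of the chain: the expectation of `F` after one step from `x`. -/
def transition (P : Measure Ω) (R : Ω → E → E) (F : E → ℝ) (x : E) : ℝ := ∫ ω, F (R ω x) ∂P

variable {P : Measure Ω} {R : Ω → E → E} {F G : E → ℝ} {b l A C : ℝ}

lemma generator_eq (hR : Measurable (Function.uncurry R)) (hF : Measurable F) (x : E) :
    generator P R b F x = b * (transition P R F x - F x) := by
  have hx : Measurable fun ω => R ω x := hR.comp (measurable_id.prodMk measurable_const)
  rw [generator, integral_map hx.aemeasurable hF.aestronglyMeasurable, transition]

lemma measurable_transition [SFinite P] (hR : Measurable (Function.uncurry R))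
    (hF : Measurable F) : Measurable (transition P R F) :=
  (((hF.comp hR).comp measurable_swap).stronglyMeasurable.integral_prod_right' (ν := P)).measurable

lemma integrable_of_abs_le [IsFiniteMeasure P] {f : Ω → ℝ} (hf : Measurable f)
    (hC : ∀ ω, |f ω| ≤ C) : Integrable f P :=
  Integrable.of_bound hf.aestronglyMeasurable C (ae_of_all _ hC)

lemma abs_integral_le_of_abs_le [IsProbabilityMeasure P] {f : Ω → ℝ} (hC : ∀ ω, |f ω| ≤ C) :
    |∫ ω, f ω ∂P| ≤ C := by
  simpa using norm_integral_le_of_norm_le_const (μ := P) (f := f) (ae_of_all _ hC)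

lemma abs_transition_le {E : Type*} {R : Ω → E → E} {F : E → ℝ} [IsProbabilityMeasure P]
    (hC : ∀ x, |F x| ≤ C) (x : E) : |transition P R F x| ≤ C :=
  abs_integral_le_of_abs_le fun _ => hC _

lemma integrable_comp_apply [IsFiniteMeasure P] (hR : Measurable (Function.uncurry R))
    (hF : Measurable F) (hC : ∀ x, |F x| ≤ C) (x : E) : Integrable (fun ω => F (R ω x)) P :=
  integrable_of_abs_le (hF.comp (hR.comp (measurable_id.prodMk measurable_const))) fun _ => hC _

/-- Maximum principle for the resolvent equation. -/
lemma IsResolventSolution.abs_le [IsProbabilityMeasure P] (hR : Measurable (Function.uncurry R))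
    (hb : 0 < b) (hl : 0 < l) (hG : ∀ x, |G x| ≤ A) (h : IsResolventSolution P R b l G F) (x : E) :
    |F x| ≤ A / l := by
  obtain ⟨hF, ⟨C, hC⟩, heq⟩ := h
  have hne : Nonempty E := ⟨x⟩
  have hbdd : BddAbove (range fun y => |F y|) := ⟨C, by rintro _ ⟨y, rfl⟩; exact hC y⟩
  set s := ⨆ y, |F y| with hs
  have hle : ∀ y, |F y| ≤ s := fun y => le_ciSup hbdd y
  have hstep : ∀ y, |F y| ≤ (A + b * s) / (l + b) := by
    intro y
    rw [le_div_iff₀ (by positivity)]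
    have h1 : (l + b) * F y = G y + b * transition P R F y := by
      rw [← heq y, generator_eq hR hF]; ring
    calc |F y| * (l + b) = |(l + b) * F y| := by
          rw [abs_mul, abs_of_pos (by positivity : 0 < l + b), mul_comm]
      _ ≤ |G y| + |b * transition P R F y| := by rw [h1]; exact abs_add_le _ _
      _ ≤ A + b * s := by
          rw [abs_mul, abs_of_pos hb]
          gcongr
          · exact hG y
          · exact abs_transition_le hle y
  have hs' : s ≤ (A + b * s) / (l + b) := ciSup_le hstep
  refine (hle x).trans ?_
  rw [le_div_iff₀ (by positivity)] at hs' ⊢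
  linarith

lemma IsResolventSolution.eq [IsProbabilityMeasure P] (hR : Measurable (Function.uncurry R))
    (hb : 0 < b) (hl : 0 < l) {F' : E → ℝ} (h : IsResolventSolution P R b l G F)
    (h' : IsResolventSolution P R b l G F') : F = F' := by
  obtain ⟨hF, ⟨C, hC⟩, heq⟩ := h
  obtain ⟨hF', ⟨C', hC'⟩, heq'⟩ := h'
  have hd : IsResolventSolution P R b l (fun _ => 0) fun x => F x - F' x := by
    refine ⟨hF.sub hF', ⟨C + C', fun x => (abs_sub _ _).trans (add_le_add (hC x) (hC' x))⟩,
      fun x => ?_⟩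
    have e := heq x
    have e' := heq' x
    rw [generator_eq hR hF] at e
    rw [generator_eq hR hF'] at e'
    have hFs : Measurable fun x => F x - F' x := hF.sub hF'
    rw [generator_eq hR hFs]
    have : transition P R (fun x => F x - F' x) x = transition P R F x - transition P R F' x :=
      integral_sub (integrable_comp_apply hR hF hC x) (integrable_comp_apply hR hF' hC' x)
    rw [this]
    linarith
  funext x
  have := hd.abs_le hR hb hl (A := 0) (fun _ => by simp) x
  rw [zero_div] at this
  exact sub_eq_zero.1 (abs_nonpos_iff.1 this)

/-- The Neumann series `∑ bⁿ Kⁿ G / (l + b)ⁿ⁺¹`, with `K` the transition operator, solves the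
resolvent equation. -/
lemma exists_isResolventSolution [IsProbabilityMeasure P] (hR : Measurable (Function.uncurry R))
    (hb : 0 < b) (hl : 0 < l) (hG : Measurable G) (hA : ∀ x, |G x| ≤ A) :
    ∃ F, IsResolventSolution P R b l G F := by
  set r := b / (l + b) with hr
  have hlb : 0 < l + b := by positivity
  have hr0 : 0 ≤ r := by positivity
  have hr1 : r < 1 := by rw [hr, div_lt_one hlb]; linarith
  set K : ℕ → E → ℝ := fun n => (transition P R)^[n] G with hK
  have hKs : ∀ n, K (n + 1) = transition P R (K n) := fun n =>
    Function.iterate_succ_apply' (transition P R) n G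
  have hKm : ∀ n, Measurable (K n) := by
    intro n
    induction n with
    | zero => exact hG
    | succ n ih => rw [hKs]; exact measurable_transition hR ih
  have hKA : ∀ n x, |K n x| ≤ A := by
    intro n
    induction n with
    | zero => exact hA
    | succ n ih => rw [hKs]; exact abs_transition_le ih
  have hgeo : Summable fun n => r ^ n * A := (summable_geometric_of_lt_one hr0 hr1).mul_right A
  have hbound : ∀ n x, |r ^ n * K n x| ≤ r ^ n * A := by
    intro n x
    rw [abs_mul, abs_of_nonneg (by positivity)]
    gcongr
    exact hKA n x
  have hsum : ∀ x, Summable fun n => r ^ n * K n x := fun x =>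
    Summable.of_norm_bounded (f := fun n => r ^ n * K n x) hgeo (hbound · x)
  set S : E → ℝ := fun x => ∑' n, r ^ n * K n x with hS
  have hSm : Measurable S := Measurable.tsum fun n => (hKm n).const_mul _
  have hSb : ∀ x, |S x| ≤ ∑' n, r ^ n * A := fun x =>
    tsum_of_norm_bounded (f := fun n => r ^ n * K n x) hgeo.hasSum (hbound · x)
  have hstep : ∀ x, HasSum (fun n => r ^ n * K (n + 1) x) (transition P R S x) := by
    intro x
    have h := hasSum_integral_of_dominated_convergence (μ := P)
      (F := fun n ω => r ^ n * K n (R ω x)) (f := fun ω => S (R ω x)) (fun n _ => r ^ n * A)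
      (fun n => (((hKm n).const_mul _).comp
        (hR.comp (measurable_id.prodMk measurable_const))).aestronglyMeasurable)
      (fun n => ae_of_all _ fun ω => hbound n _) (ae_of_all _ fun _ => hgeo)
      (integrable_const _) (ae_of_all _ fun ω => (hsum _).hasSum)
    have hterm : ∀ n, ∫ ω, r ^ n * K n (R ω x) ∂P = r ^ n * K (n + 1) x := fun n => by
      rw [integral_const_mul, hKs]
      rfl
    simp_rw [hterm] at h
    exact h
  have hfix : ∀ x, S x = G x + r * transition P R S x := by
    intro x
    have h1 : S x = r ^ 0 * K 0 x + ∑' n, r ^ (n + 1) * K (n + 1) x := (hsum x).tsum_eq_zero_add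
    have h2 : (∑' n, r ^ (n + 1) * K (n + 1) x) = r * transition P R S x := by
      rw [← (hstep x).tsum_eq, ← tsum_mul_left]
      exact tsum_congr fun n => by ring
    rw [h1, h2]
    simp [hK]
  refine ⟨fun x => (l + b)⁻¹ * S x, hSm.const_mul _, ⟨(l + b)⁻¹ * ∑' n, r ^ n * A, fun x => ?_⟩,
    fun x => ?_⟩
  · rw [abs_mul, abs_of_pos (by positivity)]
    gcongr
    exact hSb x
  · rw [generator_eq hR (hSm.const_mul _)]
    have h1 : transition P R (fun x => (l + b)⁻¹ * S x) x = (l + b)⁻¹ * transition P R S x :=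
      integral_const_mul _ _
    rw [h1]
    have h2 := hfix x
    rw [hr] at h2
    field_simp at h2 ⊢
    linarith

end Resolvent

/-! ### The chain and the process along a resolvent solution -/

section Chain

variable {Ω E : Type*} [MeasurableSpace Ω] [MeasurableSpace E]
variable {P : Measure Ω} [IsProbabilityMeasure P] {R : Ω → E → E} {F G : E → ℝ} {b l A C D : ℝ}

lemma measurable_chain (hR : Measurable (Function.uncurry R)) (x : E) (n : ℕ) :
    Measurable fun ω : ℕ → Ω => chain R x ω n := by
  induction n with
  | zero => exact measurable_const
  | succ n ih => exact hR.comp ((measurable_pi_apply n).prodMk ih)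

lemma measurable_chain_pi (hR : Measurable (Function.uncurry R)) (x : E) :
    Measurable (chain R x) :=
  measurable_pi_iff.2 (measurable_chain hR x)

lemma chain_congr {Ω E : Type*} (R : Ω → E → E) (x : E) {ω ω' : ℕ → Ω} {n : ℕ}
    (h : ∀ k < n, ω k = ω' k) : chain R x ω n = chain R x ω' n := by
  induction n with
  | zero => rfl
  | succ n ih =>
    simp only [chain]
    rw [h n (Nat.lt_succ_self n), ih fun k hk => h k (hk.trans (Nat.lt_succ_self n))]

/-- The state of the chain at time `n` only depends on the first `n` noises, so that it is
independent of the next one. -/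
lemma indepFun_chain_noise (hR : Measurable (Function.uncurry R)) (x : E) (n : ℕ) :
    ProbabilityTheory.IndepFun (fun ω : ℕ → Ω => chain R x ω n) (fun ω => ω n)
      (Measure.infinitePi fun _ : ℕ => P) := by
  classical
  have ⟨ω₀⟩ : Nonempty Ω := nonempty_of_isProbabilityMeasure P
  have hind : ProbabilityTheory.iIndepFun (fun (k : ℕ) (ω : ℕ → Ω) => ω k)
      (Measure.infinitePi fun _ : ℕ => P) :=
    ProbabilityTheory.iIndepFun_infinitePi (X := fun _ ω => ω) (fun _ => measurable_id)
  have h := hind.indepFun_finset (Finset.range n) {n} (by simp) (fun k => measurable_pi_apply k)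
  let ext : (Finset.range n → Ω) → ℕ → Ω := fun v k =>
    if hk : k ∈ Finset.range n then v ⟨k, hk⟩ else ω₀
  have hext : Measurable ext := by
    refine measurable_pi_iff.2 fun k => ?_
    by_cases hk : k ∈ Finset.range n
    · have he : (fun v => ext v k) = fun v : Finset.range n → Ω => v ⟨k, hk⟩ :=
        funext fun v => dif_pos hk
      rw [he]
      exact measurable_pi_apply _
    · have he : (fun v => ext v k) = fun _ : Finset.range n → Ω => ω₀ :=
        funext fun v => dif_neg hk
      rw [he]
      exact measurable_const
  have hlast : Measurable fun v : (({n} : Finset ℕ) → Ω) => v ⟨n, Finset.mem_singleton_self n⟩ :=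
    measurable_pi_apply _
  have h' := h.comp (φ := fun v => chain R x (ext v) n)
    (ψ := fun v : (({n} : Finset ℕ) → Ω) => v ⟨n, Finset.mem_singleton_self n⟩)
    ((measurable_chain hR x n).comp hext) hlast
  have hchain : ((fun v => chain R x (ext v) n) ∘ fun (ω : ℕ → Ω) (k : Finset.range n) => ω k) =
      fun ω => chain R x ω n :=
    funext fun ω => chain_congr R x fun k hk => by simp [ext, hk]
  rw [hchain] at h'
  exact h'

lemma integral_chain_succ (hR : Measurable (Function.uncurry R)) (hF : Measurable F)
    (hC : ∀ x, |F x| ≤ C) (x : E) (n : ℕ) :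
    ∫ ω, F (chain R x ω (n + 1)) ∂(Measure.infinitePi fun _ : ℕ => P) =
      ∫ ω, transition P R F (chain R x ω n) ∂(Measure.infinitePi fun _ : ℕ => P) := by
  set Q := Measure.infinitePi fun _ : ℕ => P
  have hX := measurable_chain hR x n
  have hmap := (ProbabilityTheory.indepFun_iff_map_prod_eq_prod_map_map hX.aemeasurable
    (measurable_pi_apply n).aemeasurable).1 (indepFun_chain_noise (P := P) hR x n)
  rw [Measure.infinitePi_map_eval (fun _ : ℕ => P) n] at hmap
  have hm : Measurable fun p : E × Ω => F (R p.2 p.1) := (hF.comp hR).comp measurable_swap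
  have : IsProbabilityMeasure (Q.map fun ω => chain R x ω n) :=
    Measure.isProbabilityMeasure_map hX.aemeasurable
  calc ∫ ω, F (chain R x ω (n + 1)) ∂Q
      = ∫ p, F (R p.2 p.1) ∂(Q.map fun ω => (chain R x ω n, ω n)) :=
        (integral_map (hX.prodMk (measurable_pi_apply n)).aemeasurable
          hm.aestronglyMeasurable).symm
    _ = ∫ p, F (R p.2 p.1) ∂((Q.map fun ω => chain R x ω n).prod P) := by rw [hmap]
    _ = ∫ y, transition P R F y ∂(Q.map fun ω => chain R x ω n) :=
        integral_prod _ (integrable_of_abs_le hm fun _ => hC _)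
    _ = _ := integral_map hX.aemeasurable (measurable_transition hR hF).aestronglyMeasurable

/-- If one step changes the expectation of `F` by at most `D`, then `n` steps change it by at most
`n * D`. -/
lemma abs_integral_chain_sub_le (hR : Measurable (Function.uncurry R)) (hF : Measurable F)
    (hC : ∀ x, |F x| ≤ C) (hD : ∀ x, |transition P R F x - F x| ≤ D) (x : E) (n : ℕ) :
    |∫ ω, F (chain R x ω n) ∂(Measure.infinitePi fun _ : ℕ => P) - F x| ≤ n * D := by
  induction n with
  | zero => simp [chain]
  | succ n ih =>
    set Q := Measure.infinitePi fun _ : ℕ => P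
    have hX := measurable_chain (Ω := Ω) hR x n
    have h1 : ∫ ω, F (chain R x ω (n + 1)) ∂Q - ∫ ω, F (chain R x ω n) ∂Q =
        ∫ ω, (transition P R F (chain R x ω n) - F (chain R x ω n)) ∂Q := by
      rw [integral_chain_succ hR hF hC, integral_sub]
      · exact integrable_of_abs_le ((measurable_transition hR hF).comp hX)
          fun _ => abs_transition_le hC _
      · exact integrable_of_abs_le (hF.comp hX) fun _ => hC _
    have h2 : |∫ ω, (transition P R F (chain R x ω n) - F (chain R x ω n)) ∂Q| ≤ D :=
      abs_integral_le_of_abs_le fun _ => hD _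
    rw [← h1] at h2
    calc _ ≤ |∫ ω, F (chain R x ω (n + 1)) ∂Q - ∫ ω, F (chain R x ω n) ∂Q| +
          |∫ ω, F (chain R x ω n) ∂Q - F x| := abs_sub_le _ _ _
      _ ≤ D + n * D := add_le_add h2 ih
      _ = _ := by push_cast; ring

lemma isProbabilityMeasure_jumpLaw (hR : Measurable (Function.uncurry R)) (x : E) :
    IsProbabilityMeasure (jumpLaw P R x) := by
  have := Measure.isProbabilityMeasure_map (μ := Measure.infinitePi fun _ : ℕ => P)
    (measurable_chain_pi hR x).aemeasurable
  unfold jumpLaw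
  infer_instance

lemma measurable_stateAt (t : ℝ) : Measurable (stateAt t : Trajectory E → E) := by
  have h : Measurable fun p : (ℕ → E) × ℕ => p.1 p.2 :=
    measurable_from_prod_countable_left fun n => measurable_pi_apply n
  exact h.comp (measurable_fst.prodMk ((measurable_jumpCount t).comp measurable_snd))

lemma measurable_speeded (b t : ℝ) : Measurable (speeded b t : Trajectory E → E) :=
  measurable_stateAt (b * t)

lemma isProbabilityMeasure_semigroupMeasure (hR : Measurable (Function.uncurry R)) (b t : ℝ)
    (x : E) : IsProbabilityMeasure (semigroupMeasure P R b t x) := by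
  have := isProbabilityMeasure_jumpLaw (P := P) hR x
  exact Measure.isProbabilityMeasure_map (measurable_speeded b t).aemeasurable

lemma integral_semigroupMeasure (hF : Measurable F) (t : ℝ) (x : E) :
    ∫ y, F y ∂(semigroupMeasure P R b t x) = ∫ w, F (speeded b t w) ∂(jumpLaw P R x) :=
  integral_map (measurable_speeded b t).aemeasurable hF.aestronglyMeasurable

/-- Conditioning on the holding times: the process at time `t` is the chain after a random number
of steps. -/
lemma integral_speeded_eq (hR : Measurable (Function.uncurry R)) (hF : Measurable F)
    (hC : ∀ x, |F x| ≤ C) (t : ℝ) (x : E) :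
    ∫ w, F (speeded b t w) ∂(jumpLaw P R x) =
      ∫ e, ∫ ω, F (chain R x ω (jumpCount e (b * t))) ∂(Measure.infinitePi fun _ : ℕ => P)
        ∂clockLaw := by
  have := Measure.isProbabilityMeasure_map (μ := Measure.infinitePi fun _ : ℕ => P)
    (measurable_chain_pi hR x).aemeasurable
  rw [jumpLaw, integral_prod_symm]
  · refine integral_congr_ae (ae_of_all _ fun e => ?_)
    exact integral_map (measurable_chain_pi hR x).aemeasurable
      (hF.comp (measurable_pi_apply (jumpCount e (b * t)))).aestronglyMeasurable
  · exact integrable_of_abs_le (hF.comp (measurable_speeded b t)) fun _ => hC _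

lemma abs_integral_speeded_sub_le (hR : Measurable (Function.uncurry R)) (hF : Measurable F)
    (hC : ∀ x, |F x| ≤ C) (hD : ∀ x, |transition P R F x - F x| ≤ D) (hb : 0 < b) {t : ℝ}
    (ht : 0 < t) (x : E) :
    |∫ w, F (speeded b t w) ∂(jumpLaw P R x) - F x| ≤ Real.exp 1 * (b * t) * D := by
  have hbt : 0 < b * t := by positivity
  have hD0 : 0 ≤ D := (abs_nonneg _).trans (hD x)
  set u : ℕ → ℝ := fun n => ∫ ω, F (chain R x ω n) ∂(Measure.infinitePi fun _ : ℕ => P)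
  have hu : Integrable (fun e => u (jumpCount e (b * t))) clockLaw :=
    integrable_of_abs_le ((measurable_from_nat (f := u)).comp (measurable_jumpCount _))
      fun e => abs_integral_le_of_abs_le fun ω => hC _
  have h1 : ∫ w, F (speeded b t w) ∂(jumpLaw P R x) - F x =
      ∫ e, (u (jumpCount e (b * t)) - F x) ∂clockLaw := by
    rw [integral_sub hu (integrable_const _), integral_speeded_eq hR hF hC]
    simp [u]
  rw [h1]
  calc _ ≤ ∫ e, |u (jumpCount e (b * t)) - F x| ∂clockLaw := abs_integral_le_integral_abs
    _ ≤ ∫ e, (jumpCount e (b * t) : ℝ) * D ∂clockLaw :=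
        integral_mono (hu.sub (integrable_const _)).abs ((integrable_jumpCount hbt).mul_const D)
          fun e => abs_integral_chain_sub_le hR hF hC hD x _
    _ = (∫ e, (jumpCount e (b * t) : ℝ) ∂clockLaw) * D := integral_mul_const _ _
    _ ≤ _ := by gcongr; exact integral_jumpCount_le hbt

/-- Over a time `t`, the expectation of a solution of the resolvent equation along the process
changes by `O(t)`, uniformly in the speed `b`: one step changes it by `O(1 / b)`, and the expected
number of steps is `O(b * t)`. -/
lemma IsResolventSolution.abs_integral_speeded_sub_le (hR : Measurable (Function.uncurry R))
    (hb : 0 < b) (hl : 0 < l) (hG : ∀ x, |G x| ≤ A) (h : IsResolventSolution P R b l G F)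
    {t : ℝ} (ht : 0 < t) (x : E) :
    |∫ w, F (speeded b t w) ∂(jumpLaw P R x) - F x| ≤ 2 * Real.exp 1 * A * t := by
  have hle := h.abs_le hR hb hl hG
  have hD : ∀ y, |transition P R F y - F y| ≤ 2 * A / b := by
    intro y
    have e := h.2.2 y
    rw [generator_eq hR h.1] at e
    rw [le_div_iff₀ hb]
    calc _ = |l * F y - G y| := by
          rw [show |transition P R F y - F y| * b = |(transition P R F y - F y) * b| by
            rw [abs_mul, abs_of_pos hb]]
          congr 1
          linarith
      _ ≤ |l * F y| + |G y| := abs_sub _ _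
      _ ≤ A + A := by
          refine add_le_add ?_ (hG y)
          rw [abs_mul, abs_of_pos hl, mul_comm]
          exact (le_div_iff₀ hl).1 (hle y)
      _ = 2 * A := by ring
  refine (Metastability.abs_integral_speeded_sub_le hR h.1 hle hD hb ht x).trans (le_of_eq ?_)
  field_simp

/-- The expectation along the process is right-continuous in time. -/
lemma tendsto_integral_speeded (hR : Measurable (Function.uncurry R)) (hF : Measurable F)
    (hC : ∀ x, |F x| ≤ C) (hb : 0 < b) (s : ℝ) (x : E) :
    Tendsto (fun t => ∫ w, F (speeded b t w) ∂(jumpLaw P R x)) (𝓝[>] s)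
      (𝓝 (∫ w, F (speeded b s w) ∂(jumpLaw P R x))) := by
  simp_rw [integral_speeded_eq (b := b) hR hF hC]
  set u : ℕ → ℝ := fun n => ∫ ω, F (chain R x ω n) ∂(Measure.infinitePi fun _ : ℕ => P)
  refine tendsto_integral_filter_of_dominated_convergence (fun _ => C)
    (F := fun t e => u (jumpCount e (b * t))) (f := fun e => u (jumpCount e (b * s)))
    (Eventually.of_forall fun t => ((measurable_from_nat (f := u)).comp
      (measurable_jumpCount (b * t))).aestronglyMeasurable)
    (Eventually.of_forall fun t => ae_of_all _ fun e => abs_integral_le_of_abs_le fun ω => hC _)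
    (integrable_const _) ?_
  have hmul : Tendsto (fun t => b * t) (𝓝[>] s) (𝓝[>] (b * s)) := by
    refine tendsto_nhdsWithin_iff.2 ⟨?_, ?_⟩
    · exact (continuous_const.mul continuous_id).continuousWithinAt
    · filter_upwards [self_mem_nhdsWithin] with t ht
      exact mul_lt_mul_of_pos_left ht hb
  filter_upwards [ae_eventually_jumpCount_eq (b * s)] with e he
  refine tendsto_nhds_of_eventually_eq ?_
  filter_upwards [hmul.eventually he] with t ht
  rw [ht]

end Chain

/-! ### Total variation, mixing times and couplings -/

section TotalVariation

variable {E : Type*} [MeasurableSpace E] {μ ν : Measure E} {F : E → ℝ} {C : ℝ}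

/-- Between probability measures the supremum defining `tvDist` is over a bounded set, so that
`tvDist` controls the integrals of bounded functions. -/
lemma abs_integral_sub_le_tvDist [IsProbabilityMeasure μ] [IsProbabilityMeasure ν]
    (hF : Measurable F) (hC0 : 0 < C) (hC : ∀ x, |F x| ≤ C) :
    |∫ x, F x ∂μ - ∫ x, F x ∂ν| ≤ 2 * C * tvDist μ ν := by
  have hbdd : BddAbove (range fun J : {J : E → ℝ // Measurable J ∧ ∀ x, |J x| ≤ 1} =>
      |∫ x, J.1 x ∂μ - ∫ x, J.1 x ∂ν|) := by
    refine ⟨1 + 1, ?_⟩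
    rintro _ ⟨J, rfl⟩
    exact (abs_sub _ _).trans (add_le_add (abs_integral_le_of_abs_le J.2.2)
      (abs_integral_le_of_abs_le J.2.2))
  have hJ : ∀ x, |C⁻¹ * F x| ≤ 1 := by
    intro x
    rw [abs_mul, abs_of_pos (inv_pos.2 hC0), inv_mul_le_iff₀ hC0, mul_one]
    exact hC x
  have h := le_ciSup hbdd ⟨fun x => C⁻¹ * F x, hF.const_mul _, hJ⟩
  simp only [integral_const_mul] at h
  rw [← mul_sub, abs_mul, abs_of_pos (inv_pos.2 hC0), inv_mul_le_iff₀ hC0] at h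
  refine h.trans (le_of_eq ?_)
  rw [tvDist]
  ring

end TotalVariation

section Mixing

variable {Ω E : Type*} [MeasurableSpace Ω] [MeasurableSpace E]
variable {P : Measure Ω} [IsProbabilityMeasure P] {R : Ω → E → E} {F : E → ℝ} {b C s h : ℝ}

/-- If the mixing time is at most `h`, then at some time `t ≤ h` the process is mixed, when tested
against `F`. The infimum defining the mixing time need not be attained: if no time in `(0, h]` is
admissible, there are admissible times decreasing to `h`, and right continuity gives `t = h`. -/
lemma exists_time_of_mixingTime_le (hR : Measurable (Function.uncurry R)) (hF : Measurable F)
    (hC0 : 0 < C) (hC : ∀ x, |F x| ≤ C) (hb : 0 < b) {μ : Measure E} [IsProbabilityMeasure μ]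
    {A : Set E} (hh : 0 < h) (hmix : mixingTime P R b μ A s ≤ ENNReal.ofReal h) :
    ∃ t, 0 < t ∧ t ≤ h ∧ ∀ x ∈ A,
      |∫ w, F (speeded b t w) ∂(jumpLaw P R x) - ∫ x, F x ∂μ| ≤ 2 * C * s := by
  have htest : ∀ t x, tvDist (semigroupMeasure P R b t x) μ ≤ s →
      |∫ w, F (speeded b t w) ∂(jumpLaw P R x) - ∫ x, F x ∂μ| ≤ 2 * C * s := by
    intro t x ht
    have := isProbabilityMeasure_semigroupMeasure (P := P) hR b t x
    rw [← integral_semigroupMeasure hF]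
    exact (abs_integral_sub_le_tvDist hF hC0 hC).trans (by gcongr)
  have happrox : ∀ u > h, ∃ t < u, 0 < t ∧
      ∀ x ∈ A, tvDist (semigroupMeasure P R b t x) μ ≤ s := by
    intro u hu
    have hlt : mixingTime P R b μ A s < ENNReal.ofReal u :=
      hmix.trans_lt ((ENNReal.ofReal_lt_ofReal_iff (hh.trans hu)).2 hu)
    simp only [mixingTime, iInf_lt_iff] at hlt
    obtain ⟨t, ⟨ht0, htA⟩, htu⟩ := hlt
    exact ⟨t, (ENNReal.ofReal_lt_ofReal_iff (hh.trans hu)).1 htu, ht0, htA⟩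
  by_cases hex : ∃ t, 0 < t ∧ t ≤ h ∧ ∀ x ∈ A, tvDist (semigroupMeasure P R b t x) μ ≤ s
  · obtain ⟨t, ht0, hth, htA⟩ := hex
    exact ⟨t, ht0, hth, fun x hx => htest t x (htA x hx)⟩
  · refine ⟨h, hh, le_rfl, fun x hx => ?_⟩
    have hfreq : ∃ᶠ t in 𝓝[>] h,
        |∫ w, F (speeded b t w) ∂(jumpLaw P R x) - ∫ x, F x ∂μ| ≤ 2 * C * s := by
      refine ((nhdsGT_basis h).frequently_iff).2 fun u hu => ?_
      obtain ⟨t, htu, ht0, htA⟩ := happrox u hu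
      refine ⟨t, ⟨?_, htu⟩, htest t x (htA x hx)⟩
      by_contra hth
      exact hex ⟨t, ht0, not_lt.1 hth, htA⟩
    have hlim := ((tendsto_integral_speeded hR hF hC hb h x (P := P)).sub_const
      (∫ x, F x ∂μ)).abs
    exact isClosed_Iic.mem_of_frequently_of_tendsto hfreq hlim

end Mixing

section Coupling

variable {Ω E : Type*} [MeasurableSpace Ω] [MeasurableSpace E]
variable {P : Measure Ω} [IsProbabilityMeasure P] {T : Ω → E → E} {V : Set E} {R : Ω → V → V}
variable {F : E → ℝ} {b C t : ℝ}

/-- Coupling inequality: two processes that agree as long as the first one has not left `V` have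
close expectations at time `t`, if the first one is unlikely to leave `V` up to time `t`. The
probability is an outer measure, since no measurability of the hitting time is used. -/
lemma abs_integral_sub_le_of_coupling (hT : Measurable (Function.uncurry T)) (hF : Measurable F)
    (hC : ∀ x, |F x| ≤ C) {x : E} {y : V} {Q : Measure (Trajectory E × Trajectory V)}
    (hQ₁ : Q.map Prod.fst = jumpLaw P T x) (hQ₂ : Q.map Prod.snd = jumpLaw P R y)
    (hQ : ∀ᵐ w ∂Q, ENNReal.ofReal t < hittingTime b Vᶜ w.1 →
      ((speeded b t w.2 : V) : E) = speeded b t w.1) :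
    |∫ w, F (speeded b t w) ∂(jumpLaw P T x) - ∫ w, F (speeded b t w : V) ∂(jumpLaw P R y)| ≤
      2 * C * (jumpLaw P T x {w | hittingTime b Vᶜ w ≤ ENNReal.ofReal t}).toReal := by
  have hlaw := isProbabilityMeasure_jumpLaw (P := P) hT x
  have hQp : IsProbabilityMeasure Q := by
    constructor
    rw [← hlaw.measure_univ, ← hQ₁, Measure.map_apply measurable_fst MeasurableSet.univ]
    simp
  have hC0 : 0 ≤ C := (abs_nonneg _).trans (hC x)
  have hm : Measurable fun w : Trajectory E => F (speeded b t w) :=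
    hF.comp (measurable_speeded b t)
  have hm' : Measurable fun w : Trajectory V => F (speeded b t w : V) :=
    (hF.comp measurable_subtype_coe).comp (measurable_speeded b t)
  set B := {w : Trajectory E | hittingTime b Vᶜ w ≤ ENNReal.ofReal t}
  have hi : Integrable (fun w : Trajectory E × Trajectory V => F (speeded b t w.1)) Q :=
    integrable_of_abs_le (hm.comp measurable_fst) fun _ => hC _
  have hi' : Integrable (fun w : Trajectory E × Trajectory V => F (speeded b t w.2 : V)) Q :=
    integrable_of_abs_le (hm'.comp measurable_snd) fun _ => hC _
  -- A measurable hull of the event that the first process has left `V`.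
  set S := toMeasurable (jumpLaw P T x) B
  have hS : MeasurableSet S := measurableSet_toMeasurable _ _
  have hQS : Q (Prod.fst ⁻¹' S) = jumpLaw P T x S := by
    rw [← Measure.map_apply measurable_fst hS, hQ₁]
  have hSQ : (Prod.fst ⁻¹' S : Set (Trajectory E × Trajectory V)).indicator (fun _ => 2 * C) =
      fun w => S.indicator (fun _ => 2 * C) w.1 := rfl
  rw [← hQ₁, ← hQ₂, integral_map measurable_fst.aemeasurable hm.aestronglyMeasurable,
    integral_map measurable_snd.aemeasurable hm'.aestronglyMeasurable, hQ₁,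
    ← measure_toMeasurable B, ← integral_sub hi hi']
  have hpt : ∀ᵐ w ∂Q, |F (speeded b t w.1) - F (speeded b t w.2 : V)| ≤
      S.indicator (fun _ => 2 * C) w.1 := by
    filter_upwards [hQ] with w hw
    by_cases hwS : w.1 ∈ S
    · rw [indicator_of_mem hwS]
      exact (abs_sub _ _).trans ((add_le_add (hC _) (hC _)).trans (le_of_eq (by ring)))
    · have hwB : w.1 ∉ B := fun h => hwS (subset_toMeasurable _ _ h)
      rw [hw (not_le.1 hwB), sub_self, abs_zero]
      exact indicator_nonneg (fun _ _ => by positivity) _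
  have hint : Integrable (fun w : Trajectory E × Trajectory V => S.indicator (fun _ => 2 * C) w.1)
      Q := by
    rw [← hSQ]
    exact (integrable_const _).indicator (measurable_fst hS)
  calc _ ≤ ∫ w, |F (speeded b t w.1) - F (speeded b t w.2 : V)| ∂Q := abs_integral_le_integral_abs
    _ ≤ ∫ w, S.indicator (fun _ => 2 * C) w.1 ∂Q :=
        integral_mono_of_nonneg (ae_of_all _ fun _ => abs_nonneg _) hint hpt
    _ = _ := by
        rw [← hSQ, integral_indicator_const _ (measurable_fst hS), Measure.real, hQS,
          smul_eq_mul, mul_comm]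

end Coupling

/-! ### Perturbed maps -/

namespace PerturbedMap

variable {Ω : Type*} [MeasurableSpace Ω] {I : Set ℝ} (M : PerturbedMap Ω I)

lemma measurableSet_well {ε : ℝ} (hε : 0 < ε) (i : Fin M.κ) : MeasurableSet (M.well ε i) :=
  (M.measurableSet_comp i).diff (MeasurableSet.iUnion fun j => MeasurableSet.iUnion fun hj =>
    M.measurableSet_hole ε hε i j hj.symm)

lemma measurable_wellFunction (g : Fin M.κ → ℝ) {ε : ℝ} (hε : 0 < ε) :
    Measurable (M.wellFunction g ε) :=
  Finset.measurable_sum _ fun i _ =>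
    (measurable_one.indicator (M.measurableSet_well hε i)).const_mul _

/-- The summand `1` keeps the bound positive when `g = 0` or there are no wells. -/
lemma abs_wellFunction_le (g : Fin M.κ → ℝ) (ε : ℝ) (x : I) :
    |M.wellFunction g ε x| ≤ ∑ i, |g i| + 1 := by
  refine (Finset.abs_sum_le_sum_abs _ _).trans (le_add_of_le_of_nonneg ?_ zero_le_one)
  refine Finset.sum_le_sum fun i _ => ?_
  by_cases hx : x ∈ M.well ε i <;> simp [hx]

variable {M} {P : Measure Ω} [IsProbabilityMeasure P]

/-- On a well, a solution of the resolvent equation is close to its mean with respect to the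
invariant measure of the restricted process. -/
lemma RestrictedProcesses.abs_sub_integral_le (D : M.RestrictedProcesses P) {ε : ℝ} (hε : 0 < ε)
    (i : Fin M.κ) {l A : ℝ} (hl : 0 < l) (hA : 0 < A) {G F : I → ℝ} (hG : ∀ x, |G x| ≤ A)
    (hF : IsResolventSolution P (M.Tε ε) (M.β ε) l G F) {h s : ℝ} (hh : 0 < h)
    (hmix : mixingTime P (D.R ε i) (M.β ε) (D.μ ε i) (Subtype.val ⁻¹' M.well ε i) s ≤
      ENNReal.ofReal h) {p : ENNReal} (hp : p ≠ ⊤)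
    (hexit : ⨆ x ∈ M.well ε i, jumpLaw P (M.Tε ε) x
        {w | hittingTime (M.β ε) (D.V ε i)ᶜ w ≤ ENNReal.ofReal h} ≤ p)
    {x : I} (hx : x ∈ M.well ε i) :
    |F x - ∫ y, F (y : I) ∂(D.μ ε i)| ≤
      2 * Real.exp 1 * A * h + 2 * (A / l) * p.toReal + 2 * (A / l) * s := by
  have hT := M.measurable_Tε ε hε
  have hR := D.measurable_R ε hε i
  have hb := M.β_pos ε hε
  have hC := hF.abs_le hT hb hl hG
  have := D.isProbabilityMeasure_μ ε hε i
  obtain ⟨t, ht0, hth, ht⟩ := exists_time_of_mixingTime_le hR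
    (hF.1.comp measurable_subtype_coe) (by positivity : 0 < A / l) (fun y => hC y) hb hh hmix
  set y : D.V ε i := ⟨x, D.well_subset ε hε i hx⟩
  obtain ⟨Q, hQ₁, hQ₂, hQ⟩ := D.coupling ε hε i y hx
  have h1 := hF.abs_integral_speeded_sub_le hT hb hl hG ht0 x
  have h2 := abs_integral_sub_le_of_coupling hT hF.1 hC hQ₁ hQ₂ (hQ t ht0)
  have h3 := ht y hx
  have h4 : (jumpLaw P (M.Tε ε) x
      {w | hittingTime (M.β ε) (D.V ε i)ᶜ w ≤ ENNReal.ofReal t}).toReal ≤ p.toReal := by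
    refine ENNReal.toReal_mono hp (le_trans (measure_mono fun w hw => ?_)
      ((le_iSup₂ (f := fun x _ => jumpLaw P (M.Tε ε) x
        {w | hittingTime (M.β ε) (D.V ε i)ᶜ w ≤ ENNReal.ofReal h}) x hx).trans hexit))
    exact le_trans hw (ENNReal.ofReal_le_ofReal hth)
  have h1' : 2 * Real.exp 1 * A * t ≤ 2 * Real.exp 1 * A * h := by gcongr
  have h2' : 2 * (A / l) * (jumpLaw P (M.Tε ε) x
      {w | hittingTime (M.β ε) (D.V ε i)ᶜ w ≤ ENNReal.ofReal t}).toReal ≤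
      2 * (A / l) * p.toReal := by gcongr
  have e1 := abs_le.1 h1
  have e2 := abs_le.1 h2
  have e3 := abs_le.1 h3
  simp only [Function.comp_apply] at e3
  rw [abs_le]
  constructor <;> linarith [e1.1, e1.2, e2.1, e2.2, e3.1, e3.2]

end PerturbedMap

end Metastability

end

theorem proposition3p1 {Ω : Type*} [MeasurableSpace Ω] (P : MeasureTheory.Measure Ω)
    [MeasureTheory.IsProbabilityMeasure P] {I : Set ℝ}
    (M : Metastability.PerturbedMap Ω I) (D : M.RestrictedProcesses P)
    (hmix : D.Mixing) : M.AsymptoticallyConstant P := by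
  intro l hl g
  set A := ∑ i, |g i| + 1 with hA
  have hA0 : 0 < A := by positivity
  have hG : ∀ ε x, |M.wellFunction g ε x| ≤ A := M.abs_wellFunction_le g
  have hex : ∀ ε, ∃ F, 0 < ε →
      Metastability.IsResolventSolution P (M.Tε ε) (M.β ε) l (M.wellFunction g ε) F := by
    intro ε
    by_cases hε : 0 < ε
    · obtain ⟨F, hF⟩ := Metastability.exists_isResolventSolution (P := P) (M.measurable_Tε ε hε)
        (M.β_pos ε hε) hl (M.measurable_wellFunction g hε) (hG ε)
      exact ⟨F, fun _ => hF⟩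
    · exact ⟨0, fun h => absurd h hε⟩
  choose F hF using hex
  refine ⟨F, fun ε hε => ⟨hF ε hε, fun F' hF' =>
    hF'.eq (M.measurable_Tε ε hε) (M.β_pos ε hε) hl (hF ε hε)⟩, fun i => ?_⟩
  obtain ⟨h, hh0, hh, hexit, s₀, hs₀, hmix⟩ := hmix
  set p : ℝ → ENNReal := fun ε => ⨆ x ∈ M.well ε i, Metastability.jumpLaw P (M.Tε ε) x
    {w | Metastability.hittingTime (M.β ε) (D.V ε i)ᶜ w ≤ ENNReal.ofReal (h ε)}
  have hp : Tendsto p (𝓝[>] 0) (𝓝 0) := hexit i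
  have hlim : ∀ s : ℝ, Tendsto (fun ε => 2 * (2 * Real.exp 1 * A * h ε +
      2 * (A / l) * (p ε).toReal + 2 * (A / l) * s)) (𝓝[>] 0) (𝓝 (4 * (A / l) * s)) := by
    intro s
    have hp' : Tendsto (fun ε => (p ε).toReal) (𝓝[>] 0) (𝓝 0) :=
      (ENNReal.tendsto_toReal ENNReal.zero_ne_top).comp hp
    have := (((hh.const_mul (2 * Real.exp 1 * A)).add (hp'.const_mul (2 * (A / l)))).add_const
      (2 * (A / l) * s)).const_mul 2
    convert this using 2
    ring
  refine ENNReal.tendsto_nhds_zero.2 fun δ hδ => ?_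
  obtain ⟨d, hd0, hdδ⟩ : ∃ d : ℝ, 0 < d ∧ ENNReal.ofReal d ≤ δ := by
    rcases eq_or_ne δ ⊤ with rfl | hδ'
    · exact ⟨1, one_pos, le_top⟩
    · exact ⟨δ.toReal, ENNReal.toReal_pos hδ.ne' hδ', ENNReal.ofReal_toReal_le⟩
  -- The mixing level `s` is chosen so that the limit `4 * (A / l) * s` is at most `d / 2`.
  set s := min (s₀ / 2) (d * l / (8 * A))
  have hs0 : 0 < s := by positivity
  have hs1 : s < s₀ := (min_le_left _ _).trans_lt (half_lt_self hs₀)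
  have hsd : 4 * (A / l) * s < d := by
    calc 4 * (A / l) * s ≤ 4 * (A / l) * (d * l / (8 * A)) := by
          gcongr
          exact min_le_right _ _
      _ = d / 2 := by field_simp; norm_num
      _ < d := half_lt_self hd0
  filter_upwards [self_mem_nhdsWithin, hmix i s hs0 hs1, (hlim s).eventually_lt_const hsd,
    hp.eventually_lt_const ENNReal.zero_lt_top] with ε hε hmε hlε hpε
  have hkey := fun x (hx : x ∈ M.well ε i) => D.abs_sub_integral_le hε i hl hA0 (hG ε) (hF ε hε)
    (hh0 ε hε) hmε hpε.ne le_rfl hx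
  refine iSup₂_le fun x hx => iSup₂_le fun y hy => le_trans (ENNReal.ofReal_le_ofReal ?_) hdδ
  have e1 := hkey x hx
  have e2 := hkey y hy
  rw [abs_sub_comm] at e2
  linarith [abs_sub_le (F ε x) (∫ z, F ε (z : I) ∂(D.μ ε i)) (F ε y)]
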